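/- Let $\mathbb K\in\{\mathbb R,\mathbb C\}$ and let $C^\infty(\mathbb R)$ be the algebra of infinitely differentiable functions $\mathbb R\to\mathbb K$, with the topology given by the seminorms $$\|f\|_n=\sup\{|f^{(j)}(x)| : |x|\le n,\ 0\le j\le n\},\qquad n\in\mathbb N_0 .$$ A Fréchet space $X$ with an increasing fundamental sequence of seminorms $(\|\cdot\|_n)_{n}$ satisfies property $(\Omega)$ if $$\forall n\ \exists m\ge n\ \forall k\ge m\ \exists s\in\mathbb N_0,\ c>0\ \forall \varepsilon>0:\ \text{every } x\in X \text{ with } \|x\|_m\le 1 \text{ can be written as } x=(x-y)+y \text{ with } y\in X,\ \|x-y\|_n\le\varepsilon,\ \|y\|_k\le c\,\varepsilon^{-s};$$ this does not depend on the choice of the fundamental sequence. **Theorem.** Every closed ideal $\mathcal I$ of $C^\infty(\mathbb R)$, with the induced topology, satisfies $(\Omega)$. Moreover, for the seminorms $\|\cdot\|_n$ above the quantities in $(\Omega)$ can be chosen independently of the ideal: for every $n\in\mathbb N_0$ there is $m\ge n$ such that for every $k\ge m$ there are $s\in\mathbb N_0$ and $c>0$ such that for every closed ideal $\mathcal I$,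 every $\varepsilon>0$ and every $f\in\mathcal I$ with $\|f\|_m\le1$ there is $g\in\mathcal I$ with $\|f-g\|_n\le\varepsilon$ and $\|g\|_k\le c\,\varepsilon^{-s}$. In particular, for every set $K\subseteq\mathbb R$ the vanishing ideal $\mathcal I_K=\{f\in C^\infty(\mathbb R): f|_K=0\}$ is closed and satisfies $(\Omega)$. -/

import Mathlib

open scoped ContDiff

/-- The `𝕜`-algebra of all functions `ℝ → 𝕜` that are smooth (infinitely often differentiable). -/
def smoothSubalgebra (𝕜 : Type*) [RCLike 𝕜] : Subalgebra 𝕜 (ℝ → 𝕜) where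
  carrier := {f | ContDiff ℝ ∞ f}
  mul_mem' := fun {f g} (hf : ContDiff ℝ ∞ f) (hg : ContDiff ℝ ∞ g) => hf.mul hg
  add_mem' := fun {f g} (hf : ContDiff ℝ ∞ f) (hg : ContDiff ℝ ∞ g) => hf.add hg
  algebraMap_mem' := fun r => (contDiff_const : ContDiff ℝ ∞ fun _ : ℝ => r)

/-- The space `C^∞(ℝ)` of smooth `𝕜`-valued functions on the real line, `𝕜 = ℝ` or `ℂ`. It is a
type of its own, so that it does not inherit the topology of pointwise convergence. -/
def SmoothFun (𝕜 : Type*) [RCLike 𝕜] : Type _ := ↥(smoothSubalgebra 𝕜)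

namespace SmoothFun

variable {𝕜 : Type*} [RCLike 𝕜]

noncomputable instance : CommRing (SmoothFun 𝕜) :=
  inferInstanceAs (CommRing ↥(smoothSubalgebra 𝕜))

noncomputable instance : Algebra 𝕜 (SmoothFun 𝕜) :=
  inferInstanceAs (Algebra 𝕜 ↥(smoothSubalgebra 𝕜))

instance : CoeFun (SmoothFun 𝕜) (fun _ => ℝ → 𝕜) := ⟨fun f => f.1⟩

theorem contDiff (f : SmoothFun 𝕜) : ContDiff ℝ ∞ (f : ℝ → 𝕜) := f.2

theorem coe_add (f g : SmoothFun 𝕜) : ((f + g : SmoothFun 𝕜) : ℝ → 𝕜) = f + g := rfl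

theorem coe_smul (a : 𝕜) (f : SmoothFun 𝕜) : ((a • f : SmoothFun 𝕜) : ℝ → 𝕜) = a • f := rfl

theorem coe_zero : ((0 : SmoothFun 𝕜) : ℝ → 𝕜) = 0 := rfl

theorem coe_mul (f g : SmoothFun 𝕜) : ((f * g : SmoothFun 𝕜) : ℝ → 𝕜) = f * g := rfl

theorem bddAbove_derivs (n : ℕ) (f : SmoothFun 𝕜) :
    BddAbove (Set.range fun q : Fin (n + 1) × Set.Icc (-(n : ℝ)) (n : ℝ) =>
      ‖iteratedDeriv (q.1 : ℕ) (f : ℝ → 𝕜) (q.2 : ℝ)‖) := by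
  refine (isCompact_range ?_).bddAbove
  refine continuous_prod_of_discrete_left.mpr fun j => ?_
  have h : Continuous (iteratedDeriv (j : ℕ) (f : ℝ → 𝕜)) :=
    f.contDiff.continuous_iteratedDeriv _ (by exact_mod_cast le_top)
  exact (h.comp continuous_subtype_val).norm

instance (n : ℕ) : Nonempty (Fin (n + 1) × Set.Icc (-(n : ℝ)) (n : ℝ)) :=
  ⟨(0, ⟨0, by simp⟩)⟩

/-- The seminorm `‖f‖ₙ = sup {|f⁽ʲ⁾(x)| : |x| ≤ n, 0 ≤ j ≤ n}` on `C^∞(ℝ)`. -/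
noncomputable def seminorm (𝕜 : Type*) [RCLike 𝕜] (n : ℕ) : Seminorm 𝕜 (SmoothFun 𝕜) :=
  Seminorm.of
    (fun f => ⨆ q : Fin (n + 1) × Set.Icc (-(n : ℝ)) (n : ℝ),
      ‖iteratedDeriv (q.1 : ℕ) (f : ℝ → 𝕜) (q.2 : ℝ)‖)
    (fun f g => by
      refine ciSup_le fun q => ?_
      have hf : ContDiffAt ℝ (q.1 : ℕ) (f : ℝ → 𝕜) q.2 :=
        (f.contDiff.of_le (by exact_mod_cast le_top)).contDiffAt
      have hg : ContDiffAt ℝ (q.1 : ℕ) (g : ℝ → 𝕜) q.2 :=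
        (g.contDiff.of_le (by exact_mod_cast le_top)).contDiffAt
      rw [coe_add, iteratedDeriv_add hf hg]
      exact (norm_add_le _ _).trans
        (add_le_add (le_ciSup (bddAbove_derivs n f) q) (le_ciSup (bddAbove_derivs n g) q)))
    (fun a f => by
      rw [Real.mul_iSup_of_nonneg (norm_nonneg a)]
      refine iSup_congr fun q => ?_
      have hf : ContDiffAt ℝ (q.1 : ℕ) (f : ℝ → 𝕜) q.2 :=
        (f.contDiff.of_le (by exact_mod_cast le_top)).contDiffAt
      rw [coe_smul, iteratedDeriv_const_smul hf a, norm_smul])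

/-- The Fréchet topology of `C^∞(ℝ)`, generated by the seminorms `‖·‖ₙ`, `n ∈ ℕ`. -/
noncomputable instance : TopologicalSpace (SmoothFun 𝕜) :=
  (SeminormFamily.moduleFilterBasis (seminorm 𝕜 : SeminormFamily 𝕜 (SmoothFun 𝕜) ℕ)).topology

/-- The vanishing ideal `{f ∈ C^∞(ℝ) : f = 0 on K}` of a set `K ⊆ ℝ`. -/
def vanishingIdeal (𝕜 : Type*) [RCLike 𝕜] (K : Set ℝ) : Ideal (SmoothFun 𝕜) where
  carrier := {f | ∀ x ∈ K, f x = 0}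
  add_mem' := fun {f g} hf hg x hx => by
    rw [coe_add, Pi.add_apply, hf x hx, hg x hx, add_zero]
  zero_mem' := fun _ _ => rfl
  smul_mem' := fun g f hf x hx => by
    rw [smul_eq_mul, coe_mul, Pi.mul_apply, hf x hx, mul_zero]

end SmoothFun

/-- The inequalities of property `(Ω)` for a sequence of seminorms `‖·‖ₙ = p n`: for all `n` there
is `m ≥ n` such that for all `k ≥ m` there are `s ∈ ℕ` and `c > 0` such that for all `ε > 0` every
`x` with `‖x‖ₘ ≤ 1` can be written as `x = (x - y) + y` with `‖x - y‖ₙ ≤ ε` and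
`‖y‖ₖ ≤ c ε⁻ˢ`. -/
def OmegaCondition {𝕜 X : Type*} [RCLike 𝕜] [AddCommGroup X] [Module 𝕜 X]
    (p : ℕ → Seminorm 𝕜 X) : Prop :=
  ∀ n : ℕ, ∃ m : ℕ, n ≤ m ∧ ∀ k : ℕ, m ≤ k → ∃ s : ℕ, ∃ c : ℝ, 0 < c ∧
    ∀ ε : ℝ, 0 < ε → ∀ x : X, p m x ≤ 1 → ∃ y : X, p n (x - y) ≤ ε ∧ p k y ≤ c / ε ^ s

/-- An increasing sequence of seminorms that generates the topology of `X`. -/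
def IsFundamentalSequence {𝕜 X : Type*} [RCLike 𝕜] [AddCommGroup X] [Module 𝕜 X]
    [TopologicalSpace X] (p : ℕ → Seminorm 𝕜 X) : Prop :=
  Monotone p ∧ WithSeminorms (p : SeminormFamily 𝕜 X ℕ)

/-- Property `(Ω)` of Vogt and Wagner for a Fréchet space `X`: some (equivalently, every, see
`OmegaCondition.of_isFundamentalSequence`) fundamental sequence of seminorms satisfies the
inequalities of `(Ω)`. -/
def HasOmega (𝕜 X : Type*) [RCLike 𝕜] [AddCommGroup X] [Module 𝕜 X] [TopologicalSpace X] : Prop :=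
  ∃ p : ℕ → Seminorm 𝕜 X, IsFundamentalSequence p ∧ OmegaCondition p

theorem IsFundamentalSequence.exists_bound {𝕜 X : Type*} [RCLike 𝕜] [AddCommGroup X] [Module 𝕜 X]
    [TopologicalSpace X] {p q : ℕ → Seminorm 𝕜 X} (hp : IsFundamentalSequence p)
    (hq : IsFundamentalSequence q) (n N : ℕ) :
    ∃ m : ℕ, N ≤ m ∧ ∃ C : ℝ, 0 < C ∧ ∀ x, q n x ≤ C * p m x := by
  obtain ⟨s, C, hC, h⟩ := Seminorm.bound_of_continuous hp.2 (q n) (hq.2.continuous_seminorm n)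
  refine ⟨max N (s.sup id), le_max_left _ _, C, NNReal.coe_pos.2 (pos_iff_ne_zero.2 hC),
    fun x => ?_⟩
  have h1 : s.sup p ≤ p (max N (s.sup id)) := Finset.sup_le fun i hi =>
    hp.1 ((Finset.le_sup (f := id) hi).trans (le_max_right _ _))
  refine (h x).trans ?_
  rw [smul_apply, NNReal.smul_def, smul_eq_mul]
  exact mul_le_mul_of_nonneg_left (h1 x) C.2

/-- The inequalities of `(Ω)` do not depend on the choice of the fundamental sequence. -/
theorem OmegaCondition.of_isFundamentalSequence {𝕜 X : Type*} [RCLike 𝕜] [AddCommGroup X]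
    [Module 𝕜 X] [TopologicalSpace X] {p q : ℕ → Seminorm 𝕜 X} (hp : IsFundamentalSequence p)
    (hq : IsFundamentalSequence q) (h : OmegaCondition p) : OmegaCondition q := by
  intro n
  obtain ⟨n', -, A, hA, hA'⟩ := hp.exists_bound hq n 0
  obtain ⟨m', -, h⟩ := h n'
  obtain ⟨m, hm, B, hB, hB'⟩ := hq.exists_bound hp m' n
  refine ⟨m, hm, fun k _ => ?_⟩
  obtain ⟨k', hk', D, hD, hD'⟩ := hp.exists_bound hq k m'
  obtain ⟨s, c, hc, h⟩ := h k' hk'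
  refine ⟨s, D * (B * (c * (A * B) ^ s)), by positivity, fun ε hε x hx => ?_⟩
  have hBn : ‖((B⁻¹ : ℝ) : 𝕜)‖ = B⁻¹ := by
    rw [RCLike.norm_ofReal, abs_of_pos (inv_pos.2 hB)]
  have hBn' : ‖(B : 𝕜)‖ = B := by
    rw [RCLike.norm_ofReal, abs_of_pos hB]
  obtain ⟨y, hy1, hy2⟩ := h (ε / (A * B)) (by positivity) (((B⁻¹ : ℝ) : 𝕜) • x) (by
    rw [map_smul_eq_mul, hBn, inv_mul_le_iff₀ hB]
    exact (hB' x).trans (mul_le_mul_of_nonneg_left hx hB.le))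
  have hB0 : (B : 𝕜) ≠ 0 := by exact_mod_cast hB.ne'
  refine ⟨(B : 𝕜) • y, ?_, ?_⟩
  · have e : x - (B : 𝕜) • y = (B : 𝕜) • ((((B⁻¹ : ℝ) : 𝕜) • x) - y) := by
      rw [smul_sub, smul_smul, RCLike.ofReal_inv, mul_inv_cancel₀ hB0, one_smul]
    rw [e]
    refine (hA' _).trans ?_
    rw [map_smul_eq_mul, hBn', ← mul_assoc, ← le_div_iff₀' (by positivity)]
    exact hy1
  · refine (hD' _).trans ?_
    rw [map_smul_eq_mul, hBn', mul_div_assoc, mul_div_assoc]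
    refine mul_le_mul_of_nonneg_left (mul_le_mul_of_nonneg_left (hy2.trans_eq ?_) hB.le) hD.le
    rw [div_pow, div_div_eq_mul_div]

/-! Locally, an ideal looks like the multiples of a polynomial, and polynomials of degree below `r`
are controlled in all derivatives by finitely many of them. Put `r = n + 2`, and take an interval of
length `2 / L`. Either all elements of the ideal share `r` zeros there, counted with multiplicity,
or the ideal is generated there by a product `Q` of fewer than `r` linear factors
(`exists_isNodal_dvd`). In the first case `f` itself is small on the interval and is replaced by `P
= 0`. In the second, `f = Q u` is replaced by a Newton interpolant `P` of degree below `r` that is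
still a multiple of `Q`. In both cases `f - P` has `r` zeros, so its `j`-th derivative is `O(L ^ (j
- r))` (`IsNodal.norm_D_mul_le`), while all derivatives of `P` are bounded independently of `L` and
of the ideal (`exists_local_approx`).

A partition of unity at scale `1 / L` glues the local pieces to `g = ∑ φᵢ Pᵢ` in the ideal. Each
piece has error `O(L⁻²)` and there are `O(L)` pieces, so the total error is `O(1 / L)`, whereas
`‖g‖ₖ = O(L ^ (k + 1))` (`exists_approx_of_scale`). Taking `L` of order `1 / ε` gives `(Ω)` with `s
= k + 1`. -/

namespace SmoothFun

variable {𝕜 : Type*} [RCLike 𝕜]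

/-! ### Derivatives of sums and products -/

@[ext]
theorem ext {f g : SmoothFun 𝕜} (h : ∀ t, f t = g t) : f = g := Subtype.ext (funext h)

theorem coe_sub (f g : SmoothFun 𝕜) : ((f - g : SmoothFun 𝕜) : ℝ → 𝕜) = f - g := rfl

theorem coe_one : ((1 : SmoothFun 𝕜) : ℝ → 𝕜) = 1 := rfl

/-- The `j`-th derivative of a smooth function. -/
noncomputable abbrev D (j : ℕ) (f : SmoothFun 𝕜) : ℝ → 𝕜 := iteratedDeriv j (f : ℝ → 𝕜)

theorem contDiffAt (f : SmoothFun 𝕜) (j : ℕ) (t : ℝ) : ContDiffAt ℝ j (f : ℝ → 𝕜) t :=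
  (f.contDiff.of_le (by exact_mod_cast le_top)).contDiffAt

theorem continuous_D (f : SmoothFun 𝕜) (j : ℕ) : Continuous (D j f) :=
  f.contDiff.continuous_iteratedDeriv _ (by exact_mod_cast le_top)

theorem hasDerivAt_D (f : SmoothFun 𝕜) (j : ℕ) (t : ℝ) : HasDerivAt (D j f) (D (j + 1) f t) t := by
  have h : Differentiable ℝ (D j f) :=
    f.contDiff.differentiable_iteratedDeriv j (by exact_mod_cast WithTop.coe_lt_top j)
  have e : D (j + 1) f = deriv (D j f) := iteratedDeriv_succ
  rw [e]
  exact (h t).hasDerivAt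

theorem D_zero (f : SmoothFun 𝕜) : D 0 f = f := iteratedDeriv_zero

theorem D_sub (f g : SmoothFun 𝕜) (j : ℕ) (t : ℝ) : D j (f - g) t = D j f t - D j g t :=
  iteratedDeriv_sub (f.contDiffAt j t) (g.contDiffAt j t)

theorem D_add (f g : SmoothFun 𝕜) (j : ℕ) (t : ℝ) : D j (f + g) t = D j f t + D j g t :=
  iteratedDeriv_add (f.contDiffAt j t) (g.contDiffAt j t)

theorem D_mul (f g : SmoothFun 𝕜) (j : ℕ) (t : ℝ) :
    D j (f * g) t = ∑ i ∈ Finset.range (j + 1), (j.choose i : 𝕜) * D i f t * D (j - i) g t :=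
  iteratedDeriv_mul (f.contDiffAt j t) (g.contDiffAt j t)

theorem coe_sum {ι : Type*} (s : Finset ι) (f : ι → SmoothFun 𝕜) (t : ℝ) :
    (∑ i ∈ s, f i : SmoothFun 𝕜) t = ∑ i ∈ s, f i t := by
  classical
  induction s using Finset.induction_on with
  | empty => rfl
  | insert a s ha ih => rw [Finset.sum_insert ha, Finset.sum_insert ha, coe_add, Pi.add_apply, ih]

theorem D_zero_fun (j : ℕ) (t : ℝ) : D j (0 : SmoothFun 𝕜) t = 0 :=
  iteratedDeriv_const_zero

theorem D_sum {ι : Type*} (s : Finset ι) (f : ι → SmoothFun 𝕜) (j : ℕ) (t : ℝ) :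
    D j (∑ i ∈ s, f i) t = ∑ i ∈ s, D j (f i) t := by
  classical
  induction s using Finset.induction_on with
  | empty => exact D_zero_fun j t
  | insert a s ha ih => rw [Finset.sum_insert ha, Finset.sum_insert ha, D_add, ih]

/-- A uniform bound on the terms of the Leibniz formula bounds the derivative of a product. -/
theorem norm_D_mul_le (f g : SmoothFun 𝕜) (j : ℕ) (t B : ℝ)
    (h : ∀ i ≤ j, ‖D i f t‖ * ‖D (j - i) g t‖ ≤ B) : ‖D j (f * g) t‖ ≤ 2 ^ j * B := by
  rw [D_mul]
  calc _ ≤ ∑ i ∈ Finset.range (j + 1), (j.choose i : ℝ) * B := by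
        refine norm_sum_le_of_le _ fun i hi => ?_
        rw [norm_mul, norm_mul, RCLike.norm_natCast, mul_assoc]
        exact mul_le_mul_of_nonneg_left (h i (Nat.lt_succ_iff.1 (Finset.mem_range.1 hi)))
          (Nat.cast_nonneg _)
    _ = 2 ^ j * B := by
        rw [← Finset.sum_mul]
        congr 1
        exact_mod_cast Nat.sum_range_choose j

/-! ### Linear factors and Hadamard's lemma -/

/-- The linear function `t ↦ t - x`. -/
noncomputable def linear (𝕜 : Type*) [RCLike 𝕜] (x : ℝ) : SmoothFun 𝕜 :=
  ⟨fun t => ((t - x : ℝ) : 𝕜),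
    show ContDiff ℝ ∞ fun t : ℝ => ((t - x : ℝ) : 𝕜) from
      (RCLike.ofRealCLM (K := 𝕜)).contDiff.comp (contDiff_id.sub contDiff_const)⟩

theorem linear_apply (x t : ℝ) : linear 𝕜 x t = ((t - x : ℝ) : 𝕜) := rfl

/-- The truncated index `j - 1` is harmless at `j = 0`, where the coefficient `j` vanishes. -/
theorem D_linear_mul (x : ℝ) (f : SmoothFun 𝕜) (j : ℕ) (t : ℝ) :
    D j (linear 𝕜 x * f) t = ((t - x : ℝ) : 𝕜) * D j f t + j * D (j - 1) f t := by
  induction j generalizing t with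
  | zero => simp [coe_mul, linear_apply]
  | succ j ih =>
    have hlin : HasDerivAt (fun t : ℝ => ((t - x : ℝ) : 𝕜)) 1 t := by
      have h := (RCLike.ofRealCLM (K := 𝕜)).hasFDerivAt.comp_hasDerivAt t
        ((hasDerivAt_id t).sub_const x)
      rw [RCLike.ofRealCLM_apply, RCLike.ofReal_one] at h
      exact h
    have h1 := hlin.mul (f.hasDerivAt_D j t)
    have h2 : HasDerivAt (fun t => (j : 𝕜) * D (j - 1) f t) (j * D j f t) t := by
      rcases j with _ | j
      · simpa using hasDerivAt_const t (0 : 𝕜)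
      · exact (f.hasDerivAt_D j t).const_mul _
    have h3 : D j (linear 𝕜 x * f) =
        fun t => ((t - x : ℝ) : 𝕜) * D j f t + j * D (j - 1) f t := funext ih
    have h4 := (linear 𝕜 x * f).hasDerivAt_D j t
    rw [h3] at h4
    rw [h4.unique (h1.add h2)]
    push_cast
    ring

/-- Off `x` the factor `t - x` is invertible; continuity and density settle the point `x`. -/
theorem linear_mul_cancel {x : ℝ} {f g : SmoothFun 𝕜} (h : linear 𝕜 x * f = linear 𝕜 x * g) :
    f = g := by
  have hd : Set.EqOn (f : ℝ → 𝕜) g {x}ᶜ := fun t ht => by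
    have h1 := congrArg (fun u : SmoothFun 𝕜 => u t) h
    refine mul_left_cancel₀ ?_ h1
    rw [linear_apply]
    exact_mod_cast sub_ne_zero.2 ht
  exact Subtype.ext (f.contDiff.continuous.ext_on (dense_compl_singleton x)
    g.contDiff.continuous hd)

/-- The `j`-th derivative of the Hadamard quotient of `f` at `x`. -/
noncomputable def hadamardQuotient (f : SmoothFun 𝕜) (x : ℝ) (j : ℕ) (t : ℝ) : 𝕜 :=
  ∫ s in (0 : ℝ)..1, s ^ j • D (j + 1) f (x + s * (t - x))

theorem hasDerivAt_hadamardQuotient (f : SmoothFun 𝕜) (x : ℝ) (j : ℕ) (t : ℝ) :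
    HasDerivAt (hadamardQuotient f x j) (hadamardQuotient f x (j + 1) t) t := by
  have hc : ∀ j, Continuous fun q : ℝ × ℝ => q.2 ^ j • D (j + 1) f (x + q.2 * (q.1 - x)) :=
    fun j => (continuous_snd.pow j).smul ((f.continuous_D (j + 1)).comp (by fun_prop))
  have hc' : ∀ j t, Continuous fun s : ℝ => s ^ j • D (j + 1) f (x + s * (t - x)) :=
    fun j t => (hc j).comp (by fun_prop : Continuous fun s : ℝ => (t, s))
  -- Compactness yields a constant dominating the `t`-derivative of the integrand.
  obtain ⟨M, hM⟩ := ((isCompact_closedBall t 1).prod (isCompact_Icc (a := (0 : ℝ)) (b := 1))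
    |>.image (hc (j + 1)).norm).bddAbove
  refine (intervalIntegral.hasDerivAt_integral_of_dominated_loc_of_deriv_le
    (F := fun t s => s ^ j • D (j + 1) f (x + s * (t - x)))
    (F' := fun t s => s ^ (j + 1) • D (j + 1 + 1) f (x + s * (t - x)))
    (s := Metric.closedBall t 1) (bound := fun _ => M)
    (Metric.closedBall_mem_nhds t one_pos)
    (Filter.Eventually.of_forall fun t => (hc' j t).aestronglyMeasurable)
    ((hc' j t).intervalIntegrable _ _) ((hc' (j + 1) t).aestronglyMeasurable)
    (Filter.Eventually.of_forall fun s hs u hu => ?_)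
    intervalIntegrable_const (Filter.Eventually.of_forall fun s hs u hu => ?_)).2
  · rw [Set.uIoc_of_le zero_le_one] at hs
    exact hM ⟨(u, s), ⟨hu, hs.1.le, hs.2⟩, rfl⟩
  · have h1 : HasDerivAt (fun u : ℝ => x + s * (u - x)) s u := by
      simpa using (((hasDerivAt_id u).sub_const x).const_mul s).const_add x
    have h2 := ((f.hasDerivAt_D (j + 1) _).scomp u h1).const_smul (s ^ j)
    rw [smul_smul, ← pow_succ] at h2
    exact h2

theorem iteratedDeriv_hadamardQuotient (f : SmoothFun 𝕜) (x : ℝ) (j : ℕ) :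
    iteratedDeriv j (hadamardQuotient f x 0) = hadamardQuotient f x j := by
  induction j with
  | zero => exact iteratedDeriv_zero
  | succ j ih =>
    rw [iteratedDeriv_succ, ih]
    exact funext fun t => (hasDerivAt_hadamardQuotient f x j t).deriv

theorem contDiff_hadamardQuotient (f : SmoothFun 𝕜) (x : ℝ) :
    ContDiff ℝ ∞ (hadamardQuotient f x 0) :=
  contDiff_of_differentiable_iteratedDeriv fun j _ => by
    rw [iteratedDeriv_hadamardQuotient]
    exact fun t => (hasDerivAt_hadamardQuotient f x j t).differentiableAt

theorem norm_hadamardQuotient_le (f : SmoothFun 𝕜) {a b x t A : ℝ} (hx : x ∈ Set.Icc a b)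
    (ht : t ∈ Set.Icc a b) (j : ℕ) (hA : ∀ s ∈ Set.Icc a b, ‖D (j + 1) f s‖ ≤ A) :
    ‖hadamardQuotient f x j t‖ ≤ A := by
  refine (intervalIntegral.norm_integral_le_of_norm_le_const (C := A) fun s hs => ?_).trans ?_
  · rw [Set.uIoc_of_le zero_le_one] at hs
    have hmem : x + s * (t - x) ∈ Set.Icc a b :=
      (convex_Icc a b).add_smul_sub_mem hx ht ⟨hs.1.le, hs.2⟩
    have h0 := hA _ hmem
    rw [norm_smul, Real.norm_eq_abs, abs_of_nonneg (pow_nonneg hs.1.le j)]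
    calc _ ≤ 1 * ‖D (j + 1) f (x + s * (t - x))‖ :=
          mul_le_mul_of_nonneg_right (pow_le_one₀ hs.1.le hs.2) (norm_nonneg _)
      _ ≤ A := by rwa [one_mul]
  · simp

/-- Hadamard's lemma: a smooth function minus its value at `x` is divisible by `t - x`. -/
theorem exists_sub_eq_linear_mul (f : SmoothFun 𝕜) (x : ℝ) :
    ∃ g : SmoothFun 𝕜, (∀ t, f t = f x + linear 𝕜 x t * g t) ∧
      ∀ j t, D j g t = hadamardQuotient f x j t := by
  refine ⟨⟨_, contDiff_hadamardQuotient f x⟩, fun t => ?_, fun j t => ?_⟩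
  · have h1 : ∀ s ∈ Set.uIcc (0 : ℝ) 1, HasDerivAt (fun s : ℝ => f (x + s * (t - x)))
        ((t - x) • D 1 f (x + s * (t - x))) s := fun s _ => by
      have h1 : HasDerivAt (fun s : ℝ => x + s * (t - x)) (t - x) s := by
        simpa using ((hasDerivAt_id s).mul_const (t - x)).const_add x
      have h2 := f.hasDerivAt_D 0 (x + s * (t - x))
      rw [D_zero] at h2
      exact h2.scomp s h1
    have h2 := intervalIntegral.integral_eq_sub_of_hasDerivAt h1
      (((f.continuous_D 1).comp (by fun_prop)).const_smul (t - x) |>.intervalIntegrable _ _)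
    rw [intervalIntegral.integral_smul] at h2
    simp only [one_mul, zero_mul, add_zero, add_sub_cancel] at h2
    rw [linear_apply, ← RCLike.real_smul_eq_coe_mul]
    simp only [hadamardQuotient, pow_zero, one_smul, zero_add]
    rw [h2, add_sub_cancel]
  · exact congrFun (iteratedDeriv_hadamardQuotient f x j) t

theorem linear_dvd {f : SmoothFun 𝕜} {x : ℝ} (h : f x = 0) : linear 𝕜 x ∣ f := by
  obtain ⟨g, hg, -⟩ := exists_sub_eq_linear_mul f x
  exact ⟨g, ext fun t => by rw [hg, h, zero_add]; rfl⟩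

/-- Dividing by `t - x` costs one derivative but no constant: by cancellation `g` is the Hadamard
quotient, an average over points of `[a, b]` with weights at most one. -/
theorem norm_D_le_of_linear_mul (g : SmoothFun 𝕜) {a b x A : ℝ} (hx : x ∈ Set.Icc a b)
    (j : ℕ) (hA : ∀ s ∈ Set.Icc a b, ‖D (j + 1) (linear 𝕜 x * g) s‖ ≤ A) :
    ∀ t ∈ Set.Icc a b, ‖D j g t‖ ≤ A := fun t ht => by
  obtain ⟨u, hu, hD⟩ := exists_sub_eq_linear_mul (linear 𝕜 x * g) x
  have : g = u := linear_mul_cancel (x := x) (ext fun t => by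
    rw [hu t, coe_mul, coe_mul, Pi.mul_apply, Pi.mul_apply, linear_apply, sub_self,
      RCLike.ofReal_zero, zero_mul, zero_add])
  rw [this, hD]
  exact norm_hadamardQuotient_le _ hx ht j hA

/-! ### Nodal products: error estimate and Newton interpolation -/

/-- `IsNodal a b r Q`: `Q` is a product `∏ (t - xᵢ)` of `r` linear factors with nodes
`xᵢ ∈ [a, b]`. -/
inductive IsNodal (a b : ℝ) : ℕ → SmoothFun 𝕜 → Prop
  | one : IsNodal a b 0 1
  | linear_mul {r : ℕ} {Q : SmoothFun 𝕜} {x : ℝ} (hx : x ∈ Set.Icc a b) (hQ : IsNodal a b r Q) :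
      IsNodal a b (r + 1) (linear 𝕜 x * Q)

/-- The condition `D j f = 0` serves throughout as "polynomial of degree less than `j`". -/
theorem D_add_eq_zero {f : SmoothFun 𝕜} {j : ℕ} (h : ∀ t, D j f t = 0) (i : ℕ) (t : ℝ) :
    D (j + i) f t = 0 := by
  induction i generalizing t with
  | zero => exact h t
  | succ i ih =>
    exact (f.hasDerivAt_D (j + i) t).unique (by
      rw [show D (j + i) f = fun _ => 0 from funext ih]
      exact hasDerivAt_const t 0)

theorem D_linear_mul_eq_zero {f : SmoothFun 𝕜} {j : ℕ} (h : ∀ t, D j f t = 0) (x t : ℝ) :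
    D (j + 1) (linear 𝕜 x * f) t = 0 := by
  rw [D_linear_mul, D_add_eq_zero h 1, Nat.add_sub_cancel, h, mul_zero, mul_zero, add_zero]

theorem IsNodal.D_eq_zero {a b : ℝ} {r : ℕ} {Q : SmoothFun 𝕜} (h : IsNodal a b r Q) (t : ℝ) :
    D (r + 1) Q t = 0 := by
  induction h generalizing t with
  | one =>
    rw [D, coe_one]
    refine (iteratedDeriv_const (c := (1 : 𝕜))).trans ?_
    simp
  | linear_mul _ _ ih => exact D_linear_mul_eq_zero ih _ t

/-- A smooth function with `r` zeros in `[a, b]` is controlled by its `r`-th derivative. -/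
theorem IsNodal.norm_D_mul_le {a b : ℝ} {r : ℕ} {Q : SmoothFun 𝕜} (h : IsNodal a b r Q)
    (v : SmoothFun 𝕜) {A : ℝ} (hA : ∀ t ∈ Set.Icc a b, ‖D r (Q * v) t‖ ≤ A) :
    ∀ j ≤ r, ∀ t ∈ Set.Icc a b, ‖D j (Q * v) t‖ ≤ r.factorial * (b - a) ^ (r - j) * A := by
  induction h with
  | one =>
    intro j hj t ht
    obtain rfl : j = 0 := by omega
    simpa using hA t ht
  | @linear_mul r Q x hx _ ih =>
    intro j hj t ht
    rw [mul_assoc] at hA ⊢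
    have hA0 : 0 ≤ A := (norm_nonneg _).trans (hA t ht)
    have hw : 0 ≤ b - a := sub_nonneg.2 (ht.1.trans ht.2)
    -- Removing the node `x` turns the bound on derivative `r + 1` into one on derivative `r`;
    -- Leibniz then restores the factor `t - x`, of size at most `b - a`.
    have ih' := ih (norm_D_le_of_linear_mul (Q * v) hx r hA)
    rcases hj.lt_or_eq with hj | rfl
    · have hjr : j ≤ r := Nat.lt_succ_iff.1 hj
      rw [D_linear_mul]
      have e1 : ‖((t - x : ℝ) : 𝕜)‖ ≤ b - a := by
        rw [RCLike.norm_ofReal, abs_le]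
        constructor <;> linarith [ht.1, ht.2, hx.1, hx.2]
      have e2 : ‖(j : 𝕜) * D (j - 1) (Q * v) t‖ ≤
          j * (r.factorial * (b - a) ^ (r + 1 - j) * A) := by
        rw [norm_mul, RCLike.norm_natCast]
        rcases Nat.eq_zero_or_pos j with rfl | hj0
        · simp
        · have := ih' (j - 1) (by omega) t ht
          rw [show r - (j - 1) = r + 1 - j by omega] at this
          exact mul_le_mul_of_nonneg_left this (Nat.cast_nonneg _)
      have e3 : ‖((t - x : ℝ) : 𝕜) * D j (Q * v) t‖ ≤ r.factorial * (b - a) ^ (r + 1 - j) * A := by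
        rw [norm_mul]
        refine (mul_le_mul e1 (ih' j hjr t ht) (norm_nonneg _) hw).trans_eq ?_
        rw [show r + 1 - j = (r - j) + 1 by omega, pow_succ]
        ring
      have e4 : 0 ≤ (r.factorial : ℝ) * (b - a) ^ (r + 1 - j) * A := by positivity
      have e5 : (j : ℝ) ≤ r := by exact_mod_cast hjr
      calc _ ≤ _ := (norm_add_le _ _).trans (add_le_add e3 e2)
        _ = (1 + j) * (r.factorial * (b - a) ^ (r + 1 - j) * A) := by ring
        _ ≤ (1 + r) * (r.factorial * (b - a) ^ (r + 1 - j) * A) := by gcongr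
        _ = _ := by rw [Nat.factorial_succ]; push_cast; ring
    · rw [Nat.sub_self, pow_zero, mul_one]
      refine (hA t ht).trans (le_mul_of_one_le_left hA0 ?_)
      exact_mod_cast Nat.factorial_pos (r + 1)

/-- Newton interpolation with the remaining nodes at the left end point. -/
theorem IsNodal.exists_interpolation {a b : ℝ} (hab : a ≤ b) {d : ℕ} {Q : SmoothFun 𝕜}
    (h : IsNodal a b d Q) (u : SmoothFun 𝕜) (e : ℕ) :
    ∃ P R : SmoothFun 𝕜, Q ∣ P ∧ (∀ t, D (d + e) P t = 0) ∧ IsNodal a b (d + e) R ∧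
      R ∣ Q * u - P := by
  induction e generalizing d Q u with
  | zero => exact ⟨0, Q, dvd_zero Q, fun t => D_zero_fun _ t, h, by simp⟩
  | succ e ih =>
    -- `Q u = u(a) Q + (t - a) Q g`: the first term goes into `P`, the second is interpolated with
    -- `a` as a further node.
    obtain ⟨g, hg, -⟩ := exists_sub_eq_linear_mul u a
    have hu : u = algebraMap 𝕜 (SmoothFun 𝕜) (u a) + linear 𝕜 a * g := ext hg
    obtain ⟨P, R, ⟨T, hT⟩, hP, hR, hd⟩ := ih (h.linear_mul ⟨le_rfl, hab⟩) g
    have hde : d + 1 + e = d + (e + 1) := by omega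
    rw [hde] at hP hR
    refine ⟨u a • Q + P, R, ?_, fun t => ?_, hR, ?_⟩
    · exact ⟨algebraMap 𝕜 (SmoothFun 𝕜) (u a) + linear 𝕜 a * T, by
        rw [hT, Algebra.smul_def]; ring⟩
    · have h1 : D (d + (e + 1)) (u a • Q) t = u a • D (d + (e + 1)) Q t :=
        iteratedDeriv_const_smul (Q.contDiffAt _ t) (u a)
      rw [D_add, hP, add_zero, h1, ← hde, D_add_eq_zero h.D_eq_zero, smul_zero]
    · convert hd using 1
      nth_rewrite 1 [hu]
      rw [Algebra.smul_def]
      ring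

/-! ### Local structure of ideals -/

/-- The complex conjugate of a smooth function. -/
noncomputable def conj (f : SmoothFun 𝕜) : SmoothFun 𝕜 :=
  ⟨fun t => starRingEnd 𝕜 (f t),
    show ContDiff ℝ ∞ fun t : ℝ => starRingEnd 𝕜 (f t) from
      (RCLike.conjCLE (K := 𝕜)).contDiff.comp f.contDiff⟩

/-- An ideal without common zeros in `[a, b]` contains every smooth function that vanishes outside
`[a, b]`. -/
theorem mem_of_eq_zero_off (J : Ideal (SmoothFun 𝕜)) {a b : ℝ}
    (hJ : ∀ x ∈ Set.Icc a b, ∃ u ∈ J, u x ≠ 0) (φ : SmoothFun 𝕜)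
    (hφ : ∀ t ∉ Set.Icc a b, φ t = 0) : φ ∈ J := by
  -- `w` is a finite sum of functions `|u|²` with `u ∈ J`; nonnegativity prevents cancellation.
  obtain ⟨w, hwJ, ρ, hρ, hpos⟩ : ∃ w ∈ J, ∃ ρ : ℝ → ℝ,
      (∀ t, w t = (ρ t : 𝕜) ∧ 0 ≤ ρ t) ∧ ∀ t ∈ Set.Icc a b, 0 < ρ t := by
    refine isCompact_Icc.induction_on
      (p := fun S => ∃ w ∈ J, ∃ ρ : ℝ → ℝ, (∀ t, w t = (ρ t : 𝕜) ∧ 0 ≤ ρ t) ∧ ∀ t ∈ S, 0 < ρ t)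
      ⟨0, J.zero_mem, 0, fun t => ⟨by simp [coe_zero], le_rfl⟩, fun t ht => ht.elim⟩
      (fun S T hST ⟨w, hw, ρ, h1, h2⟩ => ⟨w, hw, ρ, h1, fun t ht => h2 t (hST ht)⟩)
      (fun S T ⟨w, hw, ρ, h1, h2⟩ ⟨w', hw', ρ', h1', h2'⟩ => ⟨w + w', J.add_mem hw hw', ρ + ρ',
        fun t => ⟨?_, add_nonneg (h1 t).2 (h1' t).2⟩, fun t ht => ht.elim
          (fun ht => add_pos_of_pos_of_nonneg (h2 t ht) (h1' t).2)
          (fun ht => add_pos_of_nonneg_of_pos (h1 t).2 (h2' t ht))⟩) fun x hx => ?_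
    · rw [coe_add, Pi.add_apply, Pi.add_apply, RCLike.ofReal_add, (h1 t).1, (h1' t).1]
    · obtain ⟨u, hu, hux⟩ := hJ x hx
      refine ⟨{t | u t ≠ 0}, mem_nhdsWithin_of_mem_nhds
        ((isOpen_ne_fun u.contDiff.continuous continuous_const).mem_nhds hux),
        conj u * u, J.mul_mem_left _ hu, fun t => ‖u t‖ ^ 2, fun t => ⟨?_, sq_nonneg _⟩,
        fun t ht => pow_pos (norm_pos_iff.2 ht) 2⟩
      rw [coe_mul, Pi.mul_apply]
      exact (RCLike.conj_mul (u t)).trans (by norm_cast)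
  -- Off `[a, b]` the denominator may vanish, but there the quotient is locally zero.
  have hq : ContDiff ℝ ∞ fun t => φ t / w t := contDiff_iff_contDiffAt.2 fun t => by
    by_cases ht : t ∈ Set.Icc a b
    · simp only [div_eq_mul_inv]
      refine φ.contDiff.contDiffAt.mul (w.contDiff.contDiffAt.inv ?_)
      rw [(hρ t).1]
      exact_mod_cast (hpos t ht).ne'
    · refine (contDiffAt_const (c := (0 : 𝕜))).congr_of_eventuallyEq ?_
      filter_upwards [isClosed_Icc.isOpen_compl.mem_nhds ht] with s hs
      rw [hφ s hs, zero_div]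
  have he : φ = (show SmoothFun 𝕜 from ⟨_, hq⟩) * w := ext fun t => by
    change φ t = φ t / w t * w t
    by_cases ht : t ∈ Set.Icc a b
    · refine (div_mul_cancel₀ _ ?_).symm
      rw [(hρ t).1]
      exact_mod_cast (hpos t ht).ne'
    · rw [hφ t ht, zero_div, zero_mul]
  rw [he]
  exact J.mul_mem_left _ hwJ

/-- Either an ideal has `r` common zeros in `[a, b]`, or on `[a, b]` it is generated by a nodal
product of less than `r` factors. -/
theorem exists_isNodal_dvd (I : Ideal (SmoothFun 𝕜)) (a b : ℝ) (r : ℕ) :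
    ∃ (d : ℕ) (Q : SmoothFun 𝕜), IsNodal a b d Q ∧ (∀ f ∈ I, Q ∣ f) ∧
      (d = r ∨ d < r ∧ ∀ φ : SmoothFun 𝕜, (∀ t ∉ Set.Icc a b, φ t = 0) → φ * Q ∈ I) := by
  induction r with
  | zero => exact ⟨0, 1, .one, fun f _ => one_dvd f, .inl rfl⟩
  | succ r ih =>
    obtain ⟨d, Q, hQ, hI, rfl | ⟨hd, hφ⟩⟩ := ih
    -- The dichotomy is whether the ideal of all `u` with `u Q ∈ I` has a common zero, which would
    -- be a further node.
    · by_cases hx : ∃ x ∈ Set.Icc a b, ∀ u : SmoothFun 𝕜, u * Q ∈ I → u x = 0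
      · obtain ⟨x, hx, hu⟩ := hx
        refine ⟨d + 1, _, hQ.linear_mul hx, fun f hf => ?_, .inl rfl⟩
        obtain ⟨u, rfl⟩ := hI f hf
        rw [mul_comm] at hf
        rw [mul_comm (linear 𝕜 x)]
        exact mul_dvd_mul_left Q (linear_dvd (hu u hf))
      · push Not at hx
        refine ⟨d, Q, hQ, hI, .inr ⟨d.lt_succ_self, fun φ hφ => ?_⟩⟩
        let J : Ideal (SmoothFun 𝕜) := Submodule.comap (LinearMap.mulRight (SmoothFun 𝕜) Q) I
        exact mem_of_eq_zero_off J hx φ hφ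
    · exact ⟨d, Q, hQ, hI, .inr ⟨hd.trans r.lt_succ_self, hφ⟩⟩

/-- Approximation of an element of an ideal on a short interval. -/
theorem exists_local_approx (I : Ideal (SmoothFun 𝕜)) {a b : ℝ} (hab : a ≤ b) (hab2 : b - a ≤ 2)
    (r : ℕ) {f : SmoothFun 𝕜} (hfI : f ∈ I)
    (hf : ∀ j ≤ r, ∀ t ∈ Set.Icc a b, ‖D j f t‖ ≤ 1) :
    ∃ P : SmoothFun 𝕜, (∀ φ : SmoothFun 𝕜, (∀ t ∉ Set.Icc a b, φ t = 0) → φ * P ∈ I) ∧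
      (∀ j ≤ r, ∀ t ∈ Set.Icc a b, ‖D j (f - P) t‖ ≤ r.factorial * (b - a) ^ (r - j)) ∧
      ∀ j, ∀ t ∈ Set.Icc a b, ‖D j P t‖ ≤ 1 + r.factorial * 2 ^ r := by
  -- As `D r P = 0`, the `r`-th derivatives of `f - P` and `f` agree, so divisibility by `R` yields
  -- the error bound; the bound on `P` follows by the triangle inequality.
  suffices h : ∃ P R : SmoothFun 𝕜,
      (∀ φ : SmoothFun 𝕜, (∀ t ∉ Set.Icc a b, φ t = 0) → φ * P ∈ I) ∧
      (∀ t, D r P t = 0) ∧ IsNodal a b r R ∧ R ∣ f - P by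
    obtain ⟨P, R, hPI, hP, hR, v, hv⟩ := h
    have hdiff : ∀ j ≤ r, ∀ t ∈ Set.Icc a b,
        ‖D j (f - P) t‖ ≤ r.factorial * (b - a) ^ (r - j) := by
      have := hR.norm_D_mul_le v (A := 1) fun t ht => by
        rw [← hv, D_sub, hP, sub_zero]
        exact hf r le_rfl t ht
      simpa only [← hv, mul_one] using this
    refine ⟨P, hPI, hdiff, fun j t ht => ?_⟩
    rcases le_total r j with hj | hj
    · obtain ⟨i, rfl⟩ := Nat.exists_eq_add_of_le hj
      rw [D_add_eq_zero hP, norm_zero]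
      positivity
    · have e : D j P t = D j f t - D j (f - P) t := by rw [D_sub, sub_sub_cancel]
      rw [e]
      refine (norm_sub_le _ _).trans (add_le_add (hf j hj t ht) ((hdiff j hj t ht).trans ?_))
      refine mul_le_mul_of_nonneg_left ?_ (Nat.cast_nonneg _)
      calc (b - a) ^ (r - j) ≤ 2 ^ (r - j) := pow_le_pow_left₀ (sub_nonneg.2 hab) hab2 _
        _ ≤ 2 ^ r := pow_le_pow_right₀ one_le_two (Nat.sub_le r j)
  obtain ⟨d, Q, hQ, hI, rfl | ⟨hd, hφ⟩⟩ := exists_isNodal_dvd I a b r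
  · exact ⟨0, Q, fun φ _ => by rw [mul_zero]; exact I.zero_mem, fun t => D_zero_fun _ t, hQ, by
      rw [sub_zero]; exact hI f hfI⟩
  · obtain ⟨u, rfl⟩ := hI f hfI
    obtain ⟨e, rfl⟩ := Nat.exists_eq_add_of_le hd.le
    obtain ⟨P, R, ⟨T, rfl⟩, hP, hR, hRd⟩ := hQ.exists_interpolation hab u e
    refine ⟨_, R, fun φ h => ?_, hP, hR, hRd⟩
    rw [← mul_assoc]
    exact I.mul_mem_right _ (hφ φ h)

/-! ### Seminorms and the partition of unity -/

theorem seminorm_le_iff (n : ℕ) (f : SmoothFun 𝕜) (B : ℝ) :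
    seminorm 𝕜 n f ≤ B ↔ ∀ j ≤ n, ∀ t ∈ Set.Icc (-(n : ℝ)) n, ‖D j f t‖ ≤ B := by
  refine (ciSup_le_iff (bddAbove_derivs n f)).trans ⟨fun h j hj t ht => ?_, fun h q => ?_⟩
  · exact h (⟨j, Nat.lt_succ_of_le hj⟩, ⟨t, ht⟩)
  · exact h q.1 (Nat.lt_succ_iff.1 q.1.2) q.2 q.2.2

theorem norm_D_le_seminorm {n j : ℕ} (hj : j ≤ n) (f : SmoothFun 𝕜) {t : ℝ}
    (ht : t ∈ Set.Icc (-(n : ℝ)) n) : ‖D j f t‖ ≤ seminorm 𝕜 n f :=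
  (seminorm_le_iff n f _).1 le_rfl j hj t ht

theorem monotone_seminorm : Monotone (seminorm 𝕜) := fun n _ hnm f =>
  (seminorm_le_iff n f _).2 fun _ hj _ ht => norm_D_le_seminorm (hj.trans hnm) f
    (Set.Icc_subset_Icc (neg_le_neg (Nat.cast_le.2 hnm)) (Nat.cast_le.2 hnm) ht)

theorem withSeminorms_seminorm :
    WithSeminorms (seminorm 𝕜 : SeminormFamily 𝕜 (SmoothFun 𝕜) ℕ) := ⟨rfl⟩

theorem D_eq_zero_of_eventuallyEq {f : SmoothFun 𝕜} {t : ℝ} (h : ∀ᶠ s in nhds t, f s = 0)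
    (j : ℕ) : D j f t = 0 :=
  (Filter.EventuallyEq.iteratedDeriv_eq j (g := (0 : SmoothFun 𝕜)) h).trans (D_zero_fun j t)

open Real in
/-- A bump function supported in `[-1, 1]` whose integer translates sum up to one. -/
noncomputable def bump (𝕜 : Type*) [RCLike 𝕜] : SmoothFun 𝕜 :=
  ⟨fun t => ((smoothTransition (t + 1) - smoothTransition t : ℝ) : 𝕜),
    show ContDiff ℝ ∞ fun t : ℝ => ((smoothTransition (t + 1) - smoothTransition t : ℝ) : 𝕜) from
      (RCLike.ofRealCLM (K := 𝕜)).contDiff.comp ((smoothTransition.contDiff.comp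
        (contDiff_id.add contDiff_const)).sub smoothTransition.contDiff)⟩

theorem bump_eq_zero {t : ℝ} (ht : t ∉ Set.Icc (-1 : ℝ) 1) : bump 𝕜 t = 0 := by
  change ((Real.smoothTransition (t + 1) - Real.smoothTransition t : ℝ) : 𝕜) = 0
  rcases lt_or_ge t (-1) with h | h
  · rw [Real.smoothTransition.zero_of_nonpos (by linarith),
      Real.smoothTransition.zero_of_nonpos (by linarith), sub_zero, RCLike.ofReal_zero]
  · have h1 : 1 < t := lt_of_not_ge fun h1 => ht ⟨h, h1⟩
    rw [Real.smoothTransition.one_of_one_le (by linarith),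
      Real.smoothTransition.one_of_one_le (by linarith), sub_self, RCLike.ofReal_zero]

theorem D_bump_eq_zero {t : ℝ} (ht : t ∉ Set.Icc (-1 : ℝ) 1) (j : ℕ) : D j (bump 𝕜) t = 0 :=
  D_eq_zero_of_eventuallyEq
    (by filter_upwards [isClosed_Icc.isOpen_compl.mem_nhds ht] with s hs using bump_eq_zero hs) j

theorem norm_D_bump_le {j k : ℕ} (hj : j ≤ k) (t : ℝ) :
    ‖D j (bump 𝕜) t‖ ≤ seminorm 𝕜 (k + 1) (bump 𝕜) := by
  by_cases ht : t ∈ Set.Icc (-1 : ℝ) 1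
  · have hk : (1 : ℝ) ≤ ((k + 1 : ℕ) : ℝ) := by simp
    exact norm_D_le_seminorm (by omega) _ (Set.Icc_subset_Icc (neg_le_neg hk) hk ht)
  · rw [D_bump_eq_zero ht, norm_zero]
    exact apply_nonneg _ _

/-- The bump function composed with `t ↦ L t + τ`. -/
noncomputable def scaledBump (𝕜 : Type*) [RCLike 𝕜] (L τ : ℝ) : SmoothFun 𝕜 :=
  ⟨fun t => bump 𝕜 (L * t + τ), show ContDiff ℝ ∞ fun t : ℝ => bump 𝕜 (L * t + τ) from
    (bump 𝕜).contDiff.comp ((contDiff_const.mul contDiff_id).add contDiff_const)⟩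

theorem D_scaledBump (L τ : ℝ) (j : ℕ) (t : ℝ) :
    D j (scaledBump 𝕜 L τ) t = L ^ j • D j (bump 𝕜) (L * t + τ) := by
  induction j generalizing t with
  | zero => rw [D_zero, D_zero, pow_zero, one_smul]; rfl
  | succ j ih =>
    have h1 : HasDerivAt (fun t : ℝ => L * t + τ) L t := by
      simpa using ((hasDerivAt_id t).const_mul L).add_const τ
    have h2 := (((bump 𝕜).hasDerivAt_D j _).scomp t h1).const_smul (L ^ j)
    have h3 := (scaledBump 𝕜 L τ).hasDerivAt_D j t
    rw [show D j (scaledBump 𝕜 L τ) = _ from funext ih] at h3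
    rw [h3.unique h2, smul_smul, pow_succ]

theorem mem_Icc_div_iff {L : ℝ} (hL : 0 < L) (τ t : ℝ) :
    t ∈ Set.Icc ((-1 - τ) / L) ((1 - τ) / L) ↔ L * t + τ ∈ Set.Icc (-1 : ℝ) 1 := by
  rw [Set.mem_Icc, Set.mem_Icc, div_le_iff₀' hL, le_div_iff₀' hL]
  constructor <;> rintro ⟨h1, h2⟩ <;> constructor <;> linarith

/-- The sum telescopes to a difference of two transition functions, equal to `1` and `0` when `|L t|
≤ N`. -/
theorem sum_scaledBump {L t : ℝ} (N : ℕ) (h : |L * t| ≤ N) :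
    ∑ i ∈ Finset.range (2 * N + 1), scaledBump 𝕜 L ((N : ℝ) - i) t = 1 := by
  let F : ℕ → ℝ := fun i => Real.smoothTransition (L * t + N + 1 - i)
  have h1 : ∀ i : ℕ, scaledBump 𝕜 L ((N : ℝ) - i) t = ((F i - F (i + 1) : ℝ) : 𝕜) := fun i => by
    change ((Real.smoothTransition (L * t + (N - i) + 1) -
      Real.smoothTransition (L * t + (N - i)) : ℝ) : 𝕜) = _
    simp only [F]
    congr 3 <;> push_cast <;> ring_nf
  rw [Finset.sum_congr rfl fun i _ => h1 i, ← RCLike.ofReal_sum, Finset.sum_range_sub']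
  have h2 := abs_le.1 h
  simp only [F]
  rw [Real.smoothTransition.one_of_one_le (by push_cast; linarith),
    Real.smoothTransition.zero_of_nonpos (by push_cast; linarith), sub_zero, RCLike.ofReal_one]

/-! ### Gluing the local approximations -/

/-- In a Leibniz term, `i` derivatives on the cut-off cost `L ^ i`, and the interpolation error
gains the other factor. The net power `L ^ (j - n - 2)` is at most `L⁻²`. -/
theorem pow_mul_two_div_pow_le {L : ℝ} (hL : 1 ≤ L) {i j n : ℕ} (hij : i ≤ j) (hj : j ≤ n) :
    L ^ i * (2 / L) ^ (n + 2 - (j - i)) ≤ 2 ^ (n + 2) / L ^ 2 := by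
  have hL0 : 0 < L := one_pos.trans_le hL
  have e : L ^ i * (2 / L) ^ (n + 2 - (j - i)) = 2 ^ (n + 2 - (j - i)) / L ^ (n + 2 - j) := by
    rw [show n + 2 - (j - i) = i + (n + 2 - j) by omega, pow_add, pow_add, div_pow, div_pow]
    field_simp
  rw [e]
  exact div_le_div₀ (by positivity) (pow_le_pow_right₀ one_le_two (Nat.sub_le _ _))
    (by positivity) (pow_le_pow_right₀ hL (by omega))

/-- Approximation in an ideal at scale `1 / L`. -/
theorem exists_approx_of_scale (I : Ideal (SmoothFun 𝕜)) (n k L : ℕ) (hL : 1 ≤ L) (hk : n ≤ k)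
    {f : SmoothFun 𝕜} (hfI : f ∈ I) (hf : seminorm 𝕜 (n + 2) f ≤ 1) :
    ∃ g ∈ I,
      seminorm 𝕜 n (f - g) ≤ (2 * n + 3) * (2 ^ n * (seminorm 𝕜 (k + 1) (bump 𝕜) *
        ((n + 2).factorial * 2 ^ (n + 2)))) / L ∧
      seminorm 𝕜 k g ≤ (2 * n + 3) * (2 ^ k * (seminorm 𝕜 (k + 1) (bump 𝕜) *
        (1 + (n + 2).factorial * 2 ^ (n + 2)))) * L ^ (k + 1) := by
  set B := seminorm 𝕜 (k + 1) (bump 𝕜)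
  have hB : 0 ≤ B := apply_nonneg _ _
  have hL1 : (1 : ℝ) ≤ L := by exact_mod_cast hL
  have hL0 : (0 : ℝ) < L := one_pos.trans_le hL1
  -- The supports have centres `(i - N) / L` running from `-(n + 1)` to `n + 1` and radius `1 / L ≤
  -- 1`, so they stay in `[-(n + 2), n + 2]`, where `f` is controlled.
  obtain ⟨N, hN⟩ : ∃ N : ℕ, N = (n + 1) * L := ⟨_, rfl⟩
  have hNL : (N : ℝ) = (n + 1) * L := by rw [hN]; push_cast; ring
  let φ : ℕ → SmoothFun 𝕜 := fun i => scaledBump 𝕜 L ((N : ℝ) - i)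
  let a : ℕ → ℝ := fun i => (-1 - ((N : ℝ) - i)) / L
  let b : ℕ → ℝ := fun i => (1 - ((N : ℝ) - i)) / L
  have hba : ∀ i, b i - a i = 2 / L := fun i => by simp only [a, b]; ring
  have hab : ∀ i, a i ≤ b i := fun i => by
    have : 0 < 2 / (L : ℝ) := by positivity
    linarith [hba i]
  have hab2 : ∀ i, b i - a i ≤ 2 := fun i => by
    rw [hba]
    exact div_le_self zero_le_two hL1
  have hφ0 : ∀ i j t, t ∉ Set.Icc (a i) (b i) → D j (φ i) t = 0 := fun i j t ht => by
    rw [mem_Icc_div_iff hL0] at ht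
    rw [D_scaledBump, D_bump_eq_zero ht, smul_zero]
  have hφB : ∀ i, ∀ j ≤ k, ∀ t, ‖D j (φ i) t‖ ≤ (L : ℝ) ^ j * B := fun i j hj t => by
    rw [D_scaledBump, norm_smul, Real.norm_eq_abs, abs_of_nonneg (by positivity)]
    exact mul_le_mul_of_nonneg_left (norm_D_bump_le hj _) (by positivity)
  have hsub : ∀ i ∈ Finset.range (2 * N + 1),
      Set.Icc (a i) (b i) ⊆ Set.Icc (-((n + 2 : ℕ) : ℝ)) ((n + 2 : ℕ) : ℝ) := fun i hi => by
    have hi' : (i : ℝ) ≤ 2 * N := by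
      exact_mod_cast Nat.lt_succ_iff.1 (Finset.mem_range.1 hi)
    have hi0 : (0 : ℝ) ≤ i := Nat.cast_nonneg i
    refine Set.Icc_subset_Icc ?_ ?_
    · rw [le_div_iff₀ hL0]
      push_cast
      linarith
    · rw [div_le_iff₀ hL0]
      push_cast
      linarith
  have hP : ∀ i ∈ Finset.range (2 * N + 1), ∃ P : SmoothFun 𝕜,
      (∀ φ : SmoothFun 𝕜, (∀ t ∉ Set.Icc (a i) (b i), φ t = 0) → φ * P ∈ I) ∧
      (∀ j ≤ n + 2, ∀ t ∈ Set.Icc (a i) (b i),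
        ‖D j (f - P) t‖ ≤ (n + 2).factorial * (b i - a i) ^ (n + 2 - j)) ∧
      ∀ j, ∀ t ∈ Set.Icc (a i) (b i), ‖D j P t‖ ≤ 1 + (n + 2).factorial * 2 ^ (n + 2) :=
    fun i hi => exists_local_approx I (hab i) (hab2 i) (n + 2) hfI fun j hj t ht =>
      (norm_D_le_seminorm hj f (hsub i hi ht)).trans hf
  choose! P hPI hPf hPB using hP
  have hcard : (((2 * N + 1 : ℕ) : ℝ)) ≤ (2 * n + 3) * L := by
    push_cast
    rw [hNL]
    linarith
  have hsum : ∀ (j : ℕ) (h : ℕ → SmoothFun 𝕜) (t C : ℝ), 0 ≤ C →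
      (∀ i ∈ Finset.range (2 * N + 1), ‖D j (h i) t‖ ≤ C) →
      ‖D j (∑ i ∈ Finset.range (2 * N + 1), h i) t‖ ≤ (2 * n + 3) * L * C :=
    fun j h t C hC hh => by
      rw [D_sum]
      refine (norm_sum_le_of_le _ hh).trans ?_
      rw [Finset.sum_const, Finset.card_range, nsmul_eq_mul]
      exact mul_le_mul_of_nonneg_right hcard hC
  refine ⟨∑ i ∈ Finset.range (2 * N + 1), φ i * P i, I.sum_mem fun i hi => hPI i hi _
    fun t ht => by simpa only [D_zero] using hφ0 i 0 t ht, ?_, ?_⟩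
  · refine (seminorm_le_iff _ _ _).2 fun j hj t ht => ?_
    have e : f - ∑ i ∈ Finset.range (2 * N + 1), φ i * P i =
        f * (1 - ∑ i ∈ Finset.range (2 * N + 1), φ i) +
          ∑ i ∈ Finset.range (2 * N + 1), φ i * (f - P i) := by
      simp only [mul_sub, Finset.sum_sub_distrib, ← Finset.sum_mul]
      ring
    -- The cut-offs sum to one on `[-(n + 1), n + 1]`, hence near every point of `[-n, n]`, so all
    -- derivatives vanish.
    have e0 : D j (f * (1 - ∑ i ∈ Finset.range (2 * N + 1), φ i)) t = 0 := by
      refine D_eq_zero_of_eventuallyEq ?_ j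
      have hmem : t ∈ Set.Ioo (-((n : ℝ) + 1)) (n + 1) :=
        ⟨by linarith [ht.1], by linarith [ht.2]⟩
      filter_upwards [isOpen_Ioo.mem_nhds hmem] with s hs
      have hs' : |(L : ℝ) * s| ≤ N := by
        rw [abs_mul, abs_of_pos hL0, hNL, mul_comm]
        exact mul_le_mul_of_nonneg_right (abs_le.2 ⟨hs.1.le, hs.2.le⟩) hL0.le
      rw [coe_mul, Pi.mul_apply, coe_sub, Pi.sub_apply, coe_sum, sum_scaledBump N hs', coe_one,
        Pi.one_apply, sub_self, mul_zero]
    rw [e, D_add, e0, zero_add]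
    -- An error of order `L⁻²` per piece survives summation over at most `(2 n + 3) L` pieces.
    refine (hsum j _ t (2 ^ n * (B * ((n + 2).factorial * 2 ^ (n + 2))) / L ^ 2) (by positivity)
      fun i hi => ?_).trans_eq (by field_simp)
    refine (norm_D_mul_le _ _ j t (B * ((n + 2).factorial * 2 ^ (n + 2)) / L ^ 2)
      fun l hl => ?_).trans ?_
    · by_cases hmem : t ∈ Set.Icc (a i) (b i)
      · have h1 := hPf i hi (j - l) (by omega) t hmem
        rw [hba] at h1
        calc _ ≤ ((L : ℝ) ^ l * B) * ((n + 2).factorial * (2 / L) ^ (n + 2 - (j - l))) :=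
              mul_le_mul (hφB i l (by omega) t) h1 (norm_nonneg _) (by positivity)
          _ = B * (n + 2).factorial * ((L : ℝ) ^ l * (2 / L) ^ (n + 2 - (j - l))) := by ring
          _ ≤ B * (n + 2).factorial * (2 ^ (n + 2) / L ^ 2) :=
              mul_le_mul_of_nonneg_left (pow_mul_two_div_pow_le hL1 hl hj) (by positivity)
          _ = _ := by ring
      · rw [hφ0 i l t hmem, norm_zero, zero_mul]
        positivity
    · exact (mul_le_mul_of_nonneg_right (pow_le_pow_right₀ (one_le_two (α := ℝ)) hj)
        (by positivity)).trans_eq (by ring)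
  · refine (seminorm_le_iff _ _ _).2 fun j hj t _ => ?_
    refine (hsum j _ t (2 ^ k * (B * (1 + (n + 2).factorial * 2 ^ (n + 2))) * L ^ k)
      (by positivity) fun i hi => ?_).trans_eq (by ring)
    refine (norm_D_mul_le _ _ j t (B * (1 + (n + 2).factorial * 2 ^ (n + 2)) * L ^ k)
      fun l hl => ?_).trans ?_
    · by_cases hmem : t ∈ Set.Icc (a i) (b i)
      · calc _ ≤ ((L : ℝ) ^ k * B) * (1 + (n + 2).factorial * 2 ^ (n + 2)) := by
              refine mul_le_mul ((hφB i l (by omega) t).trans ?_) (hPB i hi _ t hmem)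
                (norm_nonneg _) (by positivity)
              exact mul_le_mul_of_nonneg_right (pow_le_pow_right₀ hL1 (hl.trans hj)) hB
          _ = _ := by ring
      · rw [hφ0 i l t hmem, norm_zero, zero_mul]
        positivity
    · exact (mul_le_mul_of_nonneg_right (pow_le_pow_right₀ (one_le_two (α := ℝ)) hj)
        (by positivity)).trans_eq (by ring)

/-- The inequalities of `(Ω)`, uniformly for all ideals. -/
theorem exists_uniform_omega (n : ℕ) : ∃ m : ℕ, n ≤ m ∧ ∀ k : ℕ, m ≤ k → ∃ s : ℕ, ∃ c : ℝ,
    0 < c ∧ ∀ I : Ideal (SmoothFun 𝕜), ∀ ε : ℝ, 0 < ε → ∀ f ∈ I, seminorm 𝕜 m f ≤ 1 →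
      ∃ g ∈ I, seminorm 𝕜 n (f - g) ≤ ε ∧ seminorm 𝕜 k g ≤ c / ε ^ s := by
  refine ⟨n + 2, by omega, fun k hk => ?_⟩
  have hB : 0 ≤ seminorm 𝕜 (k + 1) (bump 𝕜) := apply_nonneg _ _
  obtain ⟨C, hC, h⟩ : ∃ C : ℝ, 0 < C ∧ ∀ L : ℕ, 1 ≤ L → ∀ I : Ideal (SmoothFun 𝕜), ∀ f ∈ I,
      seminorm 𝕜 (n + 2) f ≤ 1 →
        ∃ g ∈ I, seminorm 𝕜 n (f - g) ≤ C / L ∧ seminorm 𝕜 k g ≤ C * L ^ (k + 1) := by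
    set C₁ : ℝ := (2 * n + 3) * (2 ^ n * (seminorm 𝕜 (k + 1) (bump 𝕜) *
      ((n + 2).factorial * 2 ^ (n + 2))))
    set C₂ : ℝ := (2 * n + 3) * (2 ^ k * (seminorm 𝕜 (k + 1) (bump 𝕜) *
      (1 + (n + 2).factorial * 2 ^ (n + 2))))
    have h1 : 0 ≤ C₁ := by positivity
    have h2 : 0 ≤ C₂ := by positivity
    refine ⟨C₁ + C₂ + 1, by positivity, fun L hL I f hfI hf => ?_⟩
    obtain ⟨g, hg, hg1, hg2⟩ := exists_approx_of_scale I n k L hL (by omega) hfI hf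
    exact ⟨g, hg, hg1.trans (div_le_div_of_nonneg_right (by linarith) (Nat.cast_nonneg L)),
      hg2.trans (mul_le_mul_of_nonneg_right (by linarith) (by positivity))⟩
  refine ⟨k + 1, C * (C + 2) ^ (k + 1), by positivity, fun I ε hε f hfI hf => ?_⟩
  -- For `ε ≥ 1` the choice `g = 0` suffices.
  rcases le_total 1 ε with h1 | h1
  · refine ⟨0, I.zero_mem, ?_, ?_⟩
    · rw [sub_zero]
      exact ((monotone_seminorm (Nat.le_add_right n 2) f).trans hf).trans h1
    · rw [map_zero]
      positivity
  · have hL := Nat.le_ceil (C / ε)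
    have hL' := (Nat.ceil_lt_add_one (a := C / ε) (by positivity)).le
    -- This `L` satisfies `C / L ≤ ε` and, since `ε ≤ 1`, `L ≤ C / ε + 2 ≤ (C + 2) / ε`; hence the
    -- constant `C * (C + 2) ^ (k + 1)`.
    obtain ⟨g, hg, hg1, hg2⟩ := h (⌈C / ε⌉₊ + 1) (by omega) I f hfI hf
    refine ⟨g, hg, hg1.trans ?_, hg2.trans ?_⟩
    · rw [div_le_comm₀ (by positivity) hε]
      push_cast
      linarith
    · rw [mul_div_assoc, ← div_pow]
      refine mul_le_mul_of_nonneg_left (pow_le_pow_left₀ (by positivity) ?_ _) hC.le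
      have h2 : 1 ≤ 1 / ε := (one_le_div hε).2 h1
      push_cast
      calc _ ≤ C / ε + 2 * (1 / ε) := by linarith
        _ = _ := by ring

/-! ### Property `(Ω)` for ideals, and closedness of vanishing ideals -/

theorem hasOmega_ideal (I : Ideal (SmoothFun 𝕜)) : HasOmega 𝕜 I := by
  let ι : I →ₗ[𝕜] SmoothFun 𝕜 := I.subtype.restrictScalars 𝕜
  refine ⟨fun n => (seminorm 𝕜 n).comp ι, ⟨fun n m h x => monotone_seminorm h (ι x), ?_⟩,
    fun n => ?_⟩
  · exact ι.withSeminorms_induced withSeminorms_seminorm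
  · obtain ⟨m, hm, h⟩ := exists_uniform_omega (𝕜 := 𝕜) n
    refine ⟨m, hm, fun k hk => ?_⟩
    obtain ⟨s, c, hc, h⟩ := h k hk
    refine ⟨s, c, hc, fun ε hε x hx => ?_⟩
    obtain ⟨g, hg, h1, h2⟩ := h I ε hε x x.2 hx
    exact ⟨⟨g, hg⟩, h1, h2⟩

theorem continuous_eval (x : ℝ) : Continuous fun f : SmoothFun 𝕜 => f x := by
  let ev : SmoothFun 𝕜 →ₗ[𝕜] 𝕜 :=
    { toFun := fun f => f x, map_add' := fun _ _ => rfl, map_smul' := fun _ _ => rfl }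
  -- Evaluation at `x` is bounded by any seminorm whose interval contains `x`.
  refine withSeminorms_seminorm.continuous_normedSpace_rng 𝕜 ev ⟨{⌈|x|⌉₊}, 1, fun f => ?_⟩
  have hx := abs_le.1 (Nat.le_ceil |x|)
  rw [Finset.sup_singleton, one_smul]
  exact norm_D_le_seminorm (Nat.zero_le ⌈|x|⌉₊) f hx

theorem isClosed_vanishingIdeal (K : Set ℝ) :
    IsClosed (vanishingIdeal 𝕜 K : Set (SmoothFun 𝕜)) := by
  have : (vanishingIdeal 𝕜 K : Set (SmoothFun 𝕜)) = ⋂ x ∈ K, {f | f x = 0} := by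
    ext f
    simp only [Set.mem_iInter]
    rfl
  rw [this]
  exact isClosed_biInter fun x _ => isClosed_eq (continuous_eval x) continuous_const

end SmoothFun

theorem theorem2p1 (𝕜 : Type*) [RCLike 𝕜] :
    -- every closed ideal of `C^∞(ℝ)`, as a topological vector space, satisfies `(Ω)`
    (∀ I : Ideal (SmoothFun 𝕜), IsClosed (I : Set (SmoothFun 𝕜)) → HasOmega 𝕜 I) ∧
    -- for the standard seminorms, `m`, `s` and `c` do not depend on the ideal
    (∀ n : ℕ, ∃ m : ℕ, n ≤ m ∧ ∀ k : ℕ, m ≤ k → ∃ s : ℕ, ∃ c : ℝ, 0 < c ∧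
      ∀ I : Ideal (SmoothFun 𝕜), IsClosed (I : Set (SmoothFun 𝕜)) →
        ∀ ε : ℝ, 0 < ε → ∀ f ∈ I, SmoothFun.seminorm 𝕜 m f ≤ 1 →
          ∃ g ∈ I, SmoothFun.seminorm 𝕜 n (f - g) ≤ ε ∧
            SmoothFun.seminorm 𝕜 k g ≤ c / ε ^ s) ∧
    -- in particular, this applies to the vanishing ideal of every set of reals
    (∀ K : Set ℝ, IsClosed (SmoothFun.vanishingIdeal 𝕜 K : Set (SmoothFun 𝕜)) ∧
      HasOmega 𝕜 (SmoothFun.vanishingIdeal 𝕜 K)) := by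
  refine ⟨fun I _ => SmoothFun.hasOmega_ideal I, fun n => ?_, fun K =>
    ⟨SmoothFun.isClosed_vanishingIdeal K, SmoothFun.hasOmega_ideal _⟩⟩
  obtain ⟨m, hm, h⟩ := SmoothFun.exists_uniform_omega (𝕜 := 𝕜) n
  refine ⟨m, hm, fun k hk => ?_⟩
  obtain ⟨s, c, hc, h⟩ := h k hk
  exact ⟨s, c, hc, fun I _ => h I⟩
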